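/- All varieties are varieties of monoids, $\vee$ denotes the join (the least variety containing the given ones), $\operatorname{var}\Sigma$ is the variety of all monoids satisfying the identities in $\Sigma$, $\overline{\mathbb V}$ is the variety of all monoids anti-isomorphic to monoids in $\mathbb V$, and $S^1$ is the monoid obtained from a semigroup $S$ by adjoining a new identity element. Let \[ A_0=\langle a,b\mid a^2=a,\ b^2=b,\ ab=0\rangle,\qquad E=\langle a,b,c\mid a^2=ab=0,\ ba=ca=a,\ b^2=bc=b,\ c^2=cb=c\rangle \] (presentations of semigroups with zero), let $\mathbb A_0^1$ and $\mathbb E^1$ be the monoid varieties generated by $A_0^1$ and $E^1$, respectively, and let \[ \mathbb E^1\{\sigma_2\}=\operatorname{var}\{xtx\approx xtx^2\approx x^2tx,\ xy^2x\approx x^2y^2,\ xt_1yt_2x^2y^2\approx xt_1yt_2y^2x^2\}. \] Then every monoid variety $\mathbb V$ with \[ \mathbb A_0^1\vee\mathbb E^1\{\sigma_2\}\vee\overline{\mathbb E^1\{\sigma_2\}}\ \subseteq\ \mathbb V\ \subseteq\ \mathbb A_0^1\vee\mathbb E^1\vee\overline{\mathbb E^1} \] is non-finitely based, i.e. $\mathbb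 V\neq\operatorname{var}\Sigma$ for every finite set $\Sigma$ of identities. -/

import Mathlib

/-! ### Varieties of monoids -/

universe u

/-- A variety of monoids (in a universe `u`): a class of monoids closed under submonoids,
homomorphic images and arbitrary direct products. -/
@[ext]
structure MonoidVariety where
  Mem : ∀ (M : Type u) [Monoid M], Prop
  submonoid_mem : ∀ (M : Type u) [Monoid M] (S : Submonoid M), Mem M → Mem S
  image_mem : ∀ (M N : Type u) [Monoid M] [Monoid N] (f : M →* N),
    Function.Surjective f → Mem M → Mem N
  pi_mem : ∀ (ι : Type u) (M : ι → Type u) [∀ i, Monoid (M i)],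
    (∀ i, Mem (M i)) → Mem (∀ i, M i)

/-- An identity `p.1 ≈ p.2` between two words over a countably infinite alphabet. -/
abbrev MonoidIdentity := FreeMonoid ℕ × FreeMonoid ℕ

/-- The monoid `M` satisfies the identity `p`: the two words have the same value under every
substitution of elements of `M` for the letters. -/
def MonoidIdentity.HoldsIn (p : MonoidIdentity) (M : Type u) [Monoid M] : Prop :=
  ∀ φ : FreeMonoid ℕ →* M, φ p.1 = φ p.2

namespace MonoidVariety

/-- Varieties are ordered by inclusion. -/
instance : PartialOrder MonoidVariety.{u} where
  le V W := ∀ (M : Type u) [Monoid M], V.Mem M → W.Mem M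
  le_refl _ _ _ h := h
  le_trans _ _ _ h₁ h₂ M _ h := h₂ M (h₁ M h)
  le_antisymm V W h₁ h₂ := by
    ext M _
    exact ⟨h₁ M, h₂ M⟩

/-- The join of two varieties: the least variety that contains both. -/
instance : SemilatticeSup MonoidVariety.{u} where
  sup V W :=
    { Mem := fun M _ => ∀ X : MonoidVariety.{u}, V ≤ X → W ≤ X → X.Mem M
      submonoid_mem := fun M _ S h X hV hW => X.submonoid_mem M S (h X hV hW)
      image_mem := fun M N _ _ f hf h X hV hW => X.image_mem M N f hf (h X hV hW)
      pi_mem := fun ι M _ h X hV hW => X.pi_mem ι M fun i => h i X hV hW }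
  le_sup_left _ _ M _ h _ hV _ := hV M h
  le_sup_right _ _ M _ h _ _ hW := hW M h
  sup_le _ _ X hV hW _ _ h := h X hV hW

/-- The variety generated by the monoid `G`: the least variety that contains `G`. -/
def generatedBy (G : Type u) [Monoid G] : MonoidVariety.{u} where
  Mem M _ := ∀ X : MonoidVariety.{u}, X.Mem G → X.Mem M
  submonoid_mem M _ S h X hG := X.submonoid_mem M S (h X hG)
  image_mem M N _ _ f hf h X hG := X.image_mem M N f hf (h X hG)
  pi_mem ι M _ h X hG := X.pi_mem ι M fun i => h i X hG

/-- The variety `var Γ` of all monoids that satisfy every identity in `Γ`. -/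
def ofIdentities (Γ : Set MonoidIdentity) : MonoidVariety.{u} where
  Mem M _ := ∀ p ∈ Γ, p.HoldsIn M
  submonoid_mem M _ S h p hp φ :=
    Subtype.ext (h p hp (S.subtype.comp φ))
  image_mem M N _ _ f hf h p hp φ := by
    obtain ⟨g, hg⟩ := hf.hasRightInverse
    have key : φ = f.comp (FreeMonoid.lift fun i => g (φ (FreeMonoid.of i))) := by
      ext i
      simp [hg (φ (FreeMonoid.of i))]
    rw [key]
    exact congrArg f (h p hp _)
  pi_mem ι M _ h p hp φ :=
    funext fun i => h i p hp ((Pi.evalMonoidHom M i).comp φ)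

/-- The dual variety, which consists of the monoids anti-isomorphic to the members of `V`. -/
def dual (V : MonoidVariety.{u}) : MonoidVariety.{u} where
  Mem M _ := ∃ (N : Type u) (_ : Monoid N), V.Mem N ∧ Nonempty (M ≃* Nᵐᵒᵖ)
  submonoid_mem := by
    rintro M _ S ⟨N, _, hN, ⟨e⟩⟩
    refine ⟨(S.map e.toMonoidHom).unop, inferInstance, V.submonoid_mem N _ hN, ⟨?_⟩⟩
    exact (S.equivMapOfInjective e.toMonoidHom e.injective).trans
      { toFun := fun x => MulOpposite.op ⟨x.1.unop, x.2⟩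
        invFun := fun y => ⟨MulOpposite.op y.unop.1, y.unop.2⟩
        left_inv := fun _ => rfl
        right_inv := fun _ => rfl
        map_mul' := fun _ _ => rfl }
  image_mem := by
    rintro M M' _ _ f hf ⟨N, _, hN, ⟨e⟩⟩
    refine ⟨M'ᵐᵒᵖ, inferInstance, V.image_mem N M'ᵐᵒᵖ
      { toFun := fun x => MulOpposite.op (f (e.symm (MulOpposite.op x)))
        map_one' := by simp
        map_mul' := fun x y => by simp } ?_ hN, ⟨MulEquiv.opOp M'⟩⟩
    intro y
    obtain ⟨m, hm⟩ := hf y.unop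
    exact ⟨(e m).unop, by simp [hm]⟩
  pi_mem := by
    intro ι M _ h
    choose N inst hN e using h
    refine ⟨∀ i, N i, inferInstance, V.pi_mem ι N hN, ⟨?_⟩⟩
    exact
      { toFun := fun x => MulOpposite.op fun i => ((e i).some (x i)).unop
        invFun := fun y i => (e i).some.symm (MulOpposite.op (y.unop i))
        left_inv := fun x => by funext i; simp
        right_inv := fun y => by apply MulOpposite.unop_injective; funext i; simp
        map_mul' := fun x y => by apply MulOpposite.unop_injective; funext i; simp }

/-- A variety is finitely based if it is defined by a finite set of identities. -/
def IsFinitelyBased (V : MonoidVariety.{u}) : Prop :=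
  ∃ Γ : Set MonoidIdentity, Γ.Finite ∧ V = ofIdentities Γ

end MonoidVariety

/-! ### The semigroups `A₀` and `E` -/

/-- The semigroup with zero presented by the generators `α` and the relations `r`: the quotient of
the free semigroup with an adjoined zero by the congruence that `r` generates. -/
abbrev PresentedSemigroupWithZero (α : Type)
    (r : WithZero (FreeSemigroup α) → WithZero (FreeSemigroup α) → Prop) : Type :=
  (conGen r).Quotient

/-- A generator, as an element of the free semigroup with zero. -/
def letterZ {α : Type} (i : α) : WithZero (FreeSemigroup α) :=
  ((FreeSemigroup.of i : FreeSemigroup α) : WithZero (FreeSemigroup α))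

inductive A0Gen
  | a
  | b

open A0Gen in
/-- The relations `a² = a`, `b² = b`, `ab = 0`. -/
inductive A0Rel : WithZero (FreeSemigroup A0Gen) → WithZero (FreeSemigroup A0Gen) → Prop
  | aa : A0Rel (letterZ a * letterZ a) (letterZ a)
  | bb : A0Rel (letterZ b * letterZ b) (letterZ b)
  | ab : A0Rel (letterZ a * letterZ b) 0

/-- The semigroup `A₀ = ⟨a, b ∣ a² = a, b² = b, ab = 0⟩`. -/
abbrev A0Semigroup : Type := PresentedSemigroupWithZero A0Gen A0Rel

inductive EGen
  | a
  | b
  | c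

open EGen in
/-- The relations `a² = ab = 0`, `ba = ca = a`, `b² = bc = b`, `c² = cb = c`. -/
inductive ERel : WithZero (FreeSemigroup EGen) → WithZero (FreeSemigroup EGen) → Prop
  | aa : ERel (letterZ a * letterZ a) 0
  | ab : ERel (letterZ a * letterZ b) 0
  | ba : ERel (letterZ b * letterZ a) (letterZ a)
  | ca : ERel (letterZ c * letterZ a) (letterZ a)
  | bb : ERel (letterZ b * letterZ b) (letterZ b)
  | bc : ERel (letterZ b * letterZ c) (letterZ b)
  | cc : ERel (letterZ c * letterZ c) (letterZ c)
  | cb : ERel (letterZ c * letterZ b) (letterZ c)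

/-- The semigroup `E = ⟨a, b, c ∣ a² = ab = 0, ba = ca = a, b² = bc = b, c² = cb = c⟩`. -/
abbrev ESemigroup : Type := PresentedSemigroupWithZero EGen ERel

/-! ### The varieties of the theorem -/

/-- The variety generated by `A₀¹`, where `S¹` is `S` with a new identity element. -/
def varietyA0 : MonoidVariety.{u} :=
  MonoidVariety.generatedBy (ULift.{u} (WithOne A0Semigroup))

/-- The variety generated by `E¹`. -/
def varietyE : MonoidVariety.{u} :=
  MonoidVariety.generatedBy (ULift.{u} (WithOne ESemigroup))

/-- A letter of the alphabet, as a word. -/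
def letterW (i : ℕ) : FreeMonoid ℕ := FreeMonoid.of i

/-- The identities `xtx ≈ xtx²`, `xtx² ≈ x²tx`, `xy²x ≈ x²y²` and
`σ₂ : x t₁ y t₂ x² y² ≈ x t₁ y t₂ y² x²`. -/
def identitiesESigma2 : Set MonoidIdentity :=
  let x := letterW 0
  let y := letterW 1
  let t := letterW 2
  let t₁ := letterW 2
  let t₂ := letterW 3
  {(x * t * x, x * t * x ^ 2),
    (x * t * x ^ 2, x ^ 2 * t * x),
    (x * y ^ 2 * x, x ^ 2 * y ^ 2),
    (x * t₁ * y * t₂ * x ^ 2 * y ^ 2, x * t₁ * y * t₂ * y ^ 2 * x ^ 2)}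

/-- The variety `E¹{σ₂}`. -/
def varietyESigma2 : MonoidVariety.{u} :=
  MonoidVariety.ofIdentities identitiesESigma2

/-! Write `y` for the letter `0`. `separatingIdentity n` inserts a `y` between `leftWord n` and
`rightWord n`. It holds in the upper bound: `A₀¹` does not see an inserted middle occurrence, and
`E¹` and its dual do not see it because every letter occurs at least twice
(`satisfies_A0Table_insert`, `satisfies_ETable_insert`).

From the lower bound only three consequences are used: identities of `V` hold in `A₀¹`, in
`FirstTable` and in its dual. `A₀¹` preserves the chain "last `z₀`, first `w₀`, last `z₁`, first
`w₁`, …, first `wₙ₋₁`" (`Ordered`). A gap is a `y` after the last `z₀` and before the first `wₙ₋₁`;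
the right side of the separating identity has one and the left side has none.

Apply an identity with few letters to an ordered word. By pigeonhole the last `zᵢ` and the last
`zⱼ`, `0 < i < j`, lie in the value of one occurrence of a letter `d`, hence so does the first `wᵢ`
between them. Then `d` occurs only once, and a cut inside its value leaves every `z₀` on the left
and every `wₙ₋₁` on the right. Whether there is a gap is now a question about each half separately,
answered by `FirstTable` and its dual with the cut as marker (`gap_iff_of_satisfies`).

So for a finite basis and large `n` the set `Separated n` is respected by the basis. Its syntactic
monoid lies in `V`, hence satisfies the separating identity, whose two sides it distinguishes. -/

/-! ### Multiplication tables -/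

/-- The monoid `A₀¹` as a multiplication table. -/
inductive A0Table
  | e
  | a
  | b
  | ba
  | z

namespace A0Table

/-- The multiplication of `A₀¹`. -/
def mul : A0Table → A0Table → A0Table
  | e, k => k
  | k, e => k
  | a, a => a
  | b, b => b
  | b, a => ba
  | b, ba => ba
  | ba, a => ba
  | _, _ => z

instance : Monoid A0Table where
  mul := mul
  one := e
  mul_assoc x y t := by cases x <;> cases y <;> cases t <;> rfl
  one_mul x := by cases x <;> rfl
  mul_one x := by cases x <;> rfl

theorem z_mul (k : A0Table) : z * k = z := by cases k <;> rfl

theorem mul_z (k : A0Table) : k * z = z := by cases k <;> rfl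

theorem mul_mul_mul_self (x y t : A0Table) : x * y * x * t * x = x * y * t * x := by
  cases x <;> cases y <;> cases t <;> rfl

end A0Table

/-- The monoid `E¹` as a multiplication table. -/
inductive ETable
  | e
  | a
  | b
  | c
  | ac
  | z

namespace ETable

/-- The multiplication of `E¹`. -/
def mul : ETable → ETable → ETable
  | e, k => k
  | k, e => k
  | a, c => ac
  | b, a => a
  | b, b => b
  | b, c => b
  | b, ac => ac
  | c, a => a
  | c, b => c
  | c, c => c
  | c, ac => ac
  | ac, b => ac
  | ac, c => ac
  | _, _ => z

instance : Monoid ETable where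
  mul := mul
  one := e
  mul_assoc x y t := by cases x <;> cases y <;> cases t <;> rfl
  one_mul x := by cases x <;> rfl
  mul_one x := by cases x <;> rfl

theorem mul_z (k : ETable) : k * z = z := by cases k <;> rfl

end ETable

/-- A monoid with eight elements in the variety `E¹{σ₂}`. It tells which of the letters `a` and `b`
comes first after the only occurrence of the letter `d`. -/
inductive FirstTable
  | e
  | a
  | b
  | ba
  | d
  | da
  | db
  | z

namespace FirstTable

/-- The multiplication of `FirstTable`. -/
def mul : FirstTable → FirstTable → FirstTable
  | e, k => k
  | k, e => k
  | a, a => a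
  | a, b => a
  | a, ba => a
  | b, a => ba
  | b, b => b
  | b, ba => ba
  | ba, a => ba
  | ba, b => ba
  | ba, ba => ba
  | b, d => d
  | b, da => da
  | b, db => db
  | d, a => da
  | d, b => db
  | d, ba => db
  | da, a => da
  | da, b => da
  | da, ba => da
  | db, a => db
  | db, b => db
  | db, ba => db
  | _, _ => z

instance : Monoid FirstTable where
  mul := mul
  one := e
  mul_assoc x y t := by cases x <;> cases y <;> cases t <;> rfl
  one_mul x := by cases x <;> rfl
  mul_one x := by cases x <;> rfl

theorem mul_mul_self (x t : FirstTable) : x * t * x = x * t * x ^ 2 := by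
  cases x <;> cases t <;> rfl

theorem mul_mul_sq (x t : FirstTable) : x * t * x ^ 2 = x ^ 2 * t * x := by
  cases x <;> cases t <;> rfl

theorem mul_sq_mul (x y : FirstTable) : x * y ^ 2 * x = x ^ 2 * y ^ 2 := by
  cases x <;> cases y <;> rfl

theorem sigma2 (x y t₁ t₂ : FirstTable) :
    x * t₁ * y * t₂ * x ^ 2 * y ^ 2 = x * t₁ * y * t₂ * y ^ 2 * x ^ 2 := by
  cases x <;> cases y <;> first
    -- The squares of `x` and `y` commute except for the pairs `a, b` and `a, ba` in either order,
    -- so `t₁` and `t₂` are rarely split.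
    | rw [mul_assoc, mul_assoc _ (_ ^ 2)]; rfl
    | cases t₁ <;> cases t₂ <;> rfl

end FirstTable

/-! ### Satisfaction of identities by lists of letters -/

/-- The monoid `M` satisfies the identity `p ≈ q`, where the words are given as lists. -/
def Satisfies (M : Type u) [Monoid M] (p q : List ℕ) : Prop :=
  ∀ ψ : ℕ → M, (p.map ψ).prod = (q.map ψ).prod

theorem MonoidIdentity.holdsIn_iff {M : Type u} [Monoid M] (p : MonoidIdentity) :
    p.HoldsIn M ↔ Satisfies M p.1.toList p.2.toList := by
  constructor
  · intro h ψ
    simpa [FreeMonoid.lift_apply] using h (FreeMonoid.lift ψ)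
  · intro h φ
    obtain ⟨ψ, rfl⟩ := FreeMonoid.lift.surjective φ
    simpa [FreeMonoid.lift_apply] using h ψ

universe v

theorem Satisfies.of_injective {M : Type u} {N : Type v} [Monoid M] [Monoid N] {p q : List ℕ}
    (f : M →* N) (hf : Function.Injective f) (h : Satisfies N p q) : Satisfies M p q := by
  intro ψ
  apply hf
  simpa [map_list_prod, Function.comp_def] using h (f ∘ ψ)

theorem Satisfies.of_surjective {M : Type u} {N : Type v} [Monoid M] [Monoid N] {p q : List ℕ}
    (f : M →* N) (hf : Function.Surjective f) (h : Satisfies M p q) : Satisfies N p q := by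
  intro ψ
  obtain ⟨g, hg⟩ := hf.hasRightInverse
  have := congrArg f (h (g ∘ ψ))
  have e : (⇑f ∘ g ∘ ψ) = ψ := funext fun i => hg (ψ i)
  simpa [map_list_prod, List.map_map, e] using this

theorem satisfies_ulift_iff {N : Type v} [Monoid N] {p q : List ℕ} :
    Satisfies (ULift.{u} N) p q ↔ Satisfies N p q :=
  ⟨Satisfies.of_surjective (MulEquiv.ulift : ULift.{u} N ≃* N).toMonoidHom
      (MulEquiv.ulift : ULift.{u} N ≃* N).surjective,
    Satisfies.of_injective (MulEquiv.ulift : ULift.{u} N ≃* N).toMonoidHom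
      (MulEquiv.ulift : ULift.{u} N ≃* N).injective⟩

theorem Satisfies.reverse {M : Type u} [Monoid M] {p q : List ℕ} (h : Satisfies Mᵐᵒᵖ p q) :
    Satisfies M p.reverse q.reverse := by
  intro ψ
  simpa [MulOpposite.unop_list_prod, Function.comp_def, List.map_reverse] using
    congrArg MulOpposite.unop (h (fun i => MulOpposite.op (ψ i)))

theorem Satisfies.of_reverse {M : Type u} [Monoid M] {p q : List ℕ}
    (h : Satisfies M p.reverse q.reverse) : Satisfies Mᵐᵒᵖ p q := by
  intro ψ
  apply MulOpposite.unop_injective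
  simpa [MulOpposite.unop_list_prod, Function.comp_def, List.map_reverse] using
    h (fun i => (ψ i).unop)

/-! ### The presented semigroups and the tables -/

section Presentation

variable {α : Type} {r : WithZero (FreeSemigroup α) → WithZero (FreeSemigroup α) → Prop}

/-- The class of a word in the presented semigroup. -/
def PresentedSemigroupWithZero.mk (r) (x : WithZero (FreeSemigroup α)) :
    PresentedSemigroupWithZero α r := (x : (conGen r).Quotient)

namespace PresentedSemigroupWithZero

theorem mk_mul (x y : WithZero (FreeSemigroup α)) : mk r (x * y) = mk r x * mk r y := rfl

theorem mk_eq {x y : WithZero (FreeSemigroup α)} (h : r x y) : mk r x = mk r y :=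
  (Con.eq _).2 (ConGen.Rel.of _ _ h)

theorem mk_zero_mul (x : PresentedSemigroupWithZero α r) : mk r 0 * x = mk r 0 := by
  induction x using Con.induction_on with
  | H x => exact (mk_mul 0 x).symm.trans (by rw [zero_mul])

theorem mul_mk_zero (x : PresentedSemigroupWithZero α r) : x * mk r 0 = mk r 0 := by
  induction x using Con.induction_on with
  | H x => exact (mk_mul x 0).symm.trans (by rw [mul_zero])

theorem surjective_of_letters {N : Type u} [Monoid N]
    (f : N →* WithOne (PresentedSemigroupWithZero α r))
    (h0 : ((mk r 0 : PresentedSemigroupWithZero α r) : WithOne _) ∈ Set.range f)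
    (hl : ∀ i, ((mk r (letterZ i) : PresentedSemigroupWithZero α r) : WithOne _) ∈ Set.range f) :
    Function.Surjective f := by
  intro x
  cases x with
  | one => exact ⟨1, map_one f⟩
  | coe x =>
    induction x using Con.induction_on with
    | H x =>
      induction x using WithZero.recZeroCoe with
      | zero => exact h0
      | coe x =>
        induction x using FreeSemigroup.recOnMul with
        | ih1 i => exact hl i
        | ih2 i y h₁ h₂ =>
          obtain ⟨k, hk⟩ := hl i
          obtain ⟨l, hh⟩ := h₂
          exact ⟨k * l, by rw [map_mul, hk, hh]; rfl⟩

/-- A semigroup with a zero and elements that satisfy the relations receives a homomorphism from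
the presented semigroup. -/
theorem exists_hom {N : Type u} [Monoid N] (g : α → N) (z : N) (hz : ∀ k, z * k = z)
    (hz' : ∀ k, k * z = z)
    (hr : ∀ f : WithZero (FreeSemigroup α) →ₙ* N, f 0 = z → (∀ i, f (letterZ i) = g i) →
      ∀ x y, r x y → f x = f y) :
    ∃ F : WithOne (PresentedSemigroupWithZero α r) →* N,
      F ((mk r 0 : PresentedSemigroupWithZero α r) : WithOne _) = z ∧
      ∀ i, F ((mk r (letterZ i) : PresentedSemigroupWithZero α r) : WithOne _) = g i := by
  let f : WithZero (FreeSemigroup α) →ₙ* N :=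
    { toFun := WithZero.recZeroCoe z (FreeSemigroup.lift g)
      map_mul' := fun x y => by
        induction x using WithZero.recZeroCoe with
        | zero => rw [zero_mul]; exact (hz _).symm
        | coe x =>
          induction y using WithZero.recZeroCoe with
          | zero => rw [mul_zero]; exact (hz' _).symm
          | coe y => exact map_mul (FreeSemigroup.lift g) x y }
  have hf : conGen r ≤ Con.ker f :=
    Con.conGen_le.2 fun x y h => hr f rfl (fun i => FreeSemigroup.lift_of g i) x y h
  let f' : PresentedSemigroupWithZero α r →ₙ* N :=
    { toFun := fun x => Con.liftOn x f fun a b h => hf h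
      map_mul' := fun x y => Con.induction_on₂ x y fun a b => map_mul f a b }
  exact ⟨WithOne.lift f', rfl, fun i => FreeSemigroup.lift_of g i⟩

end PresentedSemigroupWithZero

end Presentation

open PresentedSemigroupWithZero

/-- Varieties are closed under images, so surjections replace isomorphisms. `A₀¹` enters both bounds
through its table and needs both directions; `E¹` needs only the one for the upper bound. -/
theorem exists_surjective_A0_table :
    ∃ f : WithOne A0Semigroup →* A0Table, Function.Surjective f := by
  obtain ⟨F, h0, hF⟩ := exists_hom (r := A0Rel) (N := A0Table)
    (fun | .a => .a | .b => .b) .z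
    A0Table.z_mul A0Table.mul_z (by
      intro f h0 hf x y h
      cases h <;> simp only [map_mul, hf, h0] <;> rfl)
  refine ⟨F, fun k => ?_⟩
  cases k with
  | e => exact ⟨1, map_one F⟩
  | a => exact ⟨_, hF .a⟩
  | b => exact ⟨_, hF .b⟩
  | ba => exact ⟨_, (map_mul F _ _).trans (congrArg₂ (· * ·) (hF .b) (hF .a))⟩
  | z => exact ⟨_, h0⟩

theorem exists_surjective_table_A0 :
    ∃ f : A0Table →* WithOne A0Semigroup, Function.Surjective f := by
  -- The generators become opaque, so the table is checked from the relations alone.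
  obtain ⟨A, hA⟩ : ∃ A, A = mk A0Rel (letterZ .a) := ⟨_, rfl⟩
  obtain ⟨B, hB⟩ : ∃ B, B = mk A0Rel (letterZ .b) := ⟨_, rfl⟩
  obtain ⟨Z, hZ⟩ : ∃ Z, Z = mk A0Rel 0 := ⟨_, rfl⟩
  have haa : A * A = A := by rw [hA]; exact mk_eq A0Rel.aa
  have hbb : B * B = B := by rw [hB]; exact mk_eq A0Rel.bb
  have hab : A * B = Z := by rw [hA, hB, hZ]; exact mk_eq A0Rel.ab
  have hzl : ∀ x, Z * x = Z := by rw [hZ]; exact mk_zero_mul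
  have hzr : ∀ x, x * Z = Z := by rw [hZ]; exact mul_mk_zero
  -- Products are nested to the right, so relations are also needed in front of a further factor.
  have hbb' : ∀ x, B * (B * x) = B * x := fun x => by rw [← mul_assoc, hbb]
  have hab' : ∀ x, A * (B * x) = Z := fun x => by rw [← mul_assoc, hab, hzl]
  let f : A0Table →* WithOne A0Semigroup :=
    { toFun := fun
        | .e => 1
        | .a => A
        | .b => B
        | .ba => (B * A : A0Semigroup)
        | .z => Z
      map_one' := rfl
      map_mul' := fun x y => by
        cases x <;> cases y <;>
          first
            | exact (one_mul _).symm
            | exact (mul_one _).symm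
            | exact congrArg WithOne.coe
                (by simp only [mul_assoc, haa, hbb, hab, hzl, hzr, hbb', hab']) }
  refine ⟨f, surjective_of_letters f ⟨.z, by rw [← hZ]; rfl⟩ fun i => ?_⟩
  cases i with
  | a => exact ⟨.a, by rw [← hA]; rfl⟩
  | b => exact ⟨.b, by rw [← hB]; rfl⟩

theorem exists_surjective_table_E :
    ∃ f : ETable →* WithOne ESemigroup, Function.Surjective f := by
  obtain ⟨A, hA⟩ : ∃ A, A = mk ERel (letterZ .a) := ⟨_, rfl⟩
  obtain ⟨B, hB⟩ : ∃ B, B = mk ERel (letterZ .b) := ⟨_, rfl⟩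
  obtain ⟨C, hC⟩ : ∃ C, C = mk ERel (letterZ .c) := ⟨_, rfl⟩
  obtain ⟨Z, hZ⟩ : ∃ Z, Z = mk ERel 0 := ⟨_, rfl⟩
  have haa : A * A = Z := by rw [hA, hZ]; exact mk_eq ERel.aa
  have hab : A * B = Z := by rw [hA, hB, hZ]; exact mk_eq ERel.ab
  have hba : B * A = A := by rw [hA, hB]; exact mk_eq ERel.ba
  have hca : C * A = A := by rw [hA, hC]; exact mk_eq ERel.ca
  have hbb : B * B = B := by rw [hB]; exact mk_eq ERel.bb
  have hbc : B * C = B := by rw [hB, hC]; exact mk_eq ERel.bc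
  have hcc : C * C = C := by rw [hC]; exact mk_eq ERel.cc
  have hcb : C * B = C := by rw [hB, hC]; exact mk_eq ERel.cb
  have hzl : ∀ x, Z * x = Z := by rw [hZ]; exact mk_zero_mul
  have hzr : ∀ x, x * Z = Z := by rw [hZ]; exact mul_mk_zero
  have haa' : ∀ x, A * (A * x) = Z := fun x => by rw [← mul_assoc, haa, hzl]
  have hba' : ∀ x, B * (A * x) = A * x := fun x => by rw [← mul_assoc, hba]
  have hca' : ∀ x, C * (A * x) = A * x := fun x => by rw [← mul_assoc, hca]
  let f : ETable →* WithOne ESemigroup :=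
    { toFun := fun
        | .e => 1
        | .a => A
        | .b => B
        | .c => C
        | .ac => (A * C : ESemigroup)
        | .z => Z
      map_one' := rfl
      map_mul' := fun x y => by
        cases x <;> cases y <;>
          first
            | exact (one_mul _).symm
            | exact (mul_one _).symm
            | exact congrArg WithOne.coe
                (by simp only [mul_assoc, haa, hab, hba, hca, hbb, hbc, hcc, hcb, hzl, hzr, haa',
                  hba', hca']) }
  refine ⟨f, surjective_of_letters f ⟨.z, by rw [← hZ]; rfl⟩ fun i => ?_⟩
  cases i with
  | a => exact ⟨.a, by rw [← hA]; rfl⟩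
  | b => exact ⟨.b, by rw [← hB]; rfl⟩
  | c => exact ⟨.c, by rw [← hC]; rfl⟩

/-! ### Membership in the varieties of the theorem -/

namespace MonoidVariety

theorem generatedBy_self (G : Type u) [Monoid G] : (generatedBy G).Mem G := fun _ h => h

theorem generatedBy_le {G : Type u} [Monoid G] {X : MonoidVariety.{u}} (h : X.Mem G) :
    generatedBy G ≤ X := fun _ _ hM => hM X h

end MonoidVariety

theorem varietyA0_mem_table : varietyA0.Mem (ULift.{u} A0Table) := by
  obtain ⟨f, hf⟩ := exists_surjective_A0_table
  refine MonoidVariety.image_mem _ _ _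
    (MulEquiv.ulift.symm.toMonoidHom.comp (f.comp MulEquiv.ulift.toMonoidHom)) ?_
    (MonoidVariety.generatedBy_self _)
  exact MulEquiv.ulift.symm.surjective.comp (hf.comp MulEquiv.ulift.surjective)

theorem varietyESigma2_mem_table : varietyESigma2.Mem (ULift.{u} FirstTable) := by
  intro p hp
  rw [MonoidIdentity.holdsIn_iff, satisfies_ulift_iff, ← MonoidIdentity.holdsIn_iff]
  intro φ
  rcases hp with rfl | rfl | rfl | rfl <;> simp only [map_mul, map_pow]
  · exact FirstTable.mul_mul_self _ _
  · exact FirstTable.mul_mul_sq _ _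
  · exact FirstTable.mul_sq_mul _ _
  · exact FirstTable.sigma2 _ _ _ _

theorem varietyESigma2_dual_mem_table : varietyESigma2.dual.Mem (ULift.{u} FirstTableᵐᵒᵖ) :=
  ⟨ULift.{u} FirstTable, inferInstance, varietyESigma2_mem_table,
    ⟨MulEquiv.ulift.trans (MulEquiv.op MulEquiv.ulift.symm)⟩⟩

/-- An identity of the lower bound of the theorem holds in the three test monoids. -/
theorem satisfies_tables_of_le {V : MonoidVariety.{u}} {p : MonoidIdentity}
    (h : varietyA0 ⊔ varietyESigma2 ⊔ varietyESigma2.dual ≤ V)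
    (hp : ∀ (M : Type u) [Monoid M], V.Mem M → p.HoldsIn M) :
    Satisfies A0Table p.1.toList p.2.toList ∧ Satisfies FirstTable p.1.toList p.2.toList ∧
      Satisfies FirstTable p.1.toList.reverse p.2.toList.reverse := by
  have key {N : Type} [Monoid N] (hN : V.Mem (ULift.{u} N)) :
      Satisfies N p.1.toList p.2.toList :=
    satisfies_ulift_iff.1 (p.holdsIn_iff.1 (hp _ hN))
  exact ⟨key (h _ (le_sup_left (a := varietyA0 ⊔ varietyESigma2) _
      (le_sup_left (a := varietyA0) _ varietyA0_mem_table))),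
    key (h _ (le_sup_left (a := varietyA0 ⊔ varietyESigma2) _
      (le_sup_right (a := varietyA0) _ varietyESigma2_mem_table))),
    (key (h _ (le_sup_right (a := varietyA0 ⊔ varietyESigma2) _
      varietyESigma2_dual_mem_table))).reverse⟩

/-- An identity that holds in `A₀¹` and in `E¹`, together with its mirror image in `E¹`, holds in
the upper bound of the theorem. -/
theorem upper_le_ofIdentities {p : MonoidIdentity}
    (hA : Satisfies A0Table p.1.toList p.2.toList) (hE : Satisfies ETable p.1.toList p.2.toList)
    (hE' : Satisfies ETable p.1.toList.reverse p.2.toList.reverse) :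
    varietyA0.{u} ⊔ varietyE ⊔ varietyE.dual ≤ MonoidVariety.ofIdentities {p} := by
  obtain ⟨f, hf⟩ := exists_surjective_table_A0
  obtain ⟨g, hg⟩ := exists_surjective_table_E
  have up {N N' : Type} [Monoid N] [Monoid N'] (k : N →* N') (hk : Function.Surjective k)
      (s : MonoidIdentity) (hN : Satisfies N s.1.toList s.2.toList) :
      (MonoidVariety.ofIdentities {s}).Mem (ULift.{u} N') := by
    intro t ht
    rw [Set.mem_singleton_iff.1 ht, MonoidIdentity.holdsIn_iff]
    exact satisfies_ulift_iff.2 (hN.of_surjective k hk)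
  refine sup_le (sup_le (MonoidVariety.generatedBy_le (up f hf p hA))
    (MonoidVariety.generatedBy_le (up g hg p hE))) ?_
  rintro M _ ⟨N, _, hN, ⟨e⟩⟩ t ht
  rw [Set.mem_singleton_iff.1 ht, MonoidIdentity.holdsIn_iff]
  refine Satisfies.of_injective e.toMonoidHom e.injective (Satisfies.of_reverse ?_)
  have := MonoidVariety.generatedBy_le
    (up g hg (FreeMonoid.ofList p.1.toList.reverse, FreeMonoid.ofList p.2.toList.reverse) hE') N hN
  exact (MonoidIdentity.holdsIn_iff _).1 (this _ rfl)

/-! ### Scattered subwords and the order of occurrences -/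

section Lists

theorem pair_sublist_append {a b : ℕ} {l m : List ℕ} :
    [a, b].Sublist (l ++ m) ↔ [a, b].Sublist l ∨ (a ∈ l ∧ b ∈ m) ∨ [a, b].Sublist m := by
  induction l with
  | nil => simp
  | cons c l ih =>
    simp only [List.cons_append, List.cons_sublist_cons', ih, List.singleton_sublist,
      List.mem_append, List.mem_cons]
    tauto

/-- Some `y` occurs in the word `l` and no `x` occurs before it. -/
def FirstBefore (y x : ℕ) (l : List ℕ) : Prop := ∃ A B, l = A ++ y :: B ∧ x ∉ A

theorem not_firstBefore_nil (y x : ℕ) : ¬ FirstBefore y x [] := by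
  rintro ⟨A, B, h, -⟩
  simp at h

theorem firstBefore_cons_self (y x : ℕ) (l : List ℕ) : FirstBefore y x (y :: l) :=
  ⟨[], l, rfl, by simp⟩

theorem not_firstBefore_cons {y x : ℕ} (h : x ≠ y) (l : List ℕ) : ¬ FirstBefore y x (x :: l) := by
  rintro ⟨A, B, e, hA⟩
  cases A with
  | nil => simp [h] at e
  | cons c A =>
    rw [List.cons_append, List.cons.injEq] at e
    simp [e.1] at hA

theorem firstBefore_cons_of_ne {y x c : ℕ} (hx : c ≠ x) (hy : c ≠ y) (l : List ℕ) :
    FirstBefore y x (c :: l) ↔ FirstBefore y x l := by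
  constructor
  · rintro ⟨A, B, e, hA⟩
    cases A with
    | nil => simp [hy] at e
    | cons c' A =>
      rw [List.cons_append, List.cons.injEq] at e
      exact ⟨A, B, e.2, fun h => hA (List.mem_cons_of_mem _ h)⟩
  · rintro ⟨A, B, rfl, hA⟩
    exact ⟨c :: A, B, rfl, by simp [hA, hx.symm]⟩

theorem not_firstBefore_append {y x : ℕ} {l : List ℕ} (hy : y ∉ l) (hx : x ∈ l) (m : List ℕ) :
    ¬ FirstBefore y x (l ++ m) := by
  induction l with
  | nil => simp at hx
  | cons c l ih =>
    have hc : c ≠ y := fun h => hy (by simp [h])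
    by_cases h : c = x
    · subst h
      exact not_firstBefore_cons hc _
    · rw [List.cons_append, firstBefore_cons_of_ne h hc]
      exact ih (fun h => hy (List.mem_cons_of_mem _ h)) ((List.mem_cons.1 hx).resolve_left (Ne.symm h))

/-- Some `y` occurs in the word `l` after all the `s` and before all the `x`. -/
def Gap (y s x : ℕ) (l : List ℕ) : Prop := ∃ A B, l = A ++ y :: B ∧ s ∉ B ∧ x ∉ A

/-- A `y` in the left half only has to avoid a later `s`, one in the right half only an earlier `x`.
Each condition is of the kind that `FirstTable` or its dual detects. -/
theorem gap_append_iff {y s x : ℕ} {l m : List ℕ} (hl : x ∉ l) (hm : s ∉ m) :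
    Gap y s x (l ++ m) ↔ FirstBefore y s l.reverse ∨ FirstBefore y x m := by
  constructor
  · rintro ⟨A, B, e, hB, hA⟩
    rcases List.append_eq_append_iff.1 e with ⟨C, rfl, rfl⟩ | ⟨C, rfl, h⟩
    · exact .inr ⟨C, B, rfl, fun h => hA (List.mem_append_right _ h)⟩
    · cases C with
      | nil => exact .inr ⟨[], B, h.symm, by simp⟩
      | cons c C =>
        rw [List.cons_append, List.cons.injEq] at h
        obtain ⟨rfl, rfl⟩ := h
        refine .inl ⟨C.reverse, A.reverse, by simp, fun h => hB ?_⟩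
        exact List.mem_append_left _ (List.mem_reverse.1 h)
  · rintro (⟨A, B, e, hA⟩ | ⟨A, B, rfl, hA⟩)
    · refine ⟨B.reverse, A.reverse ++ m, ?_, by simp [hA, hm], ?_⟩
      · rw [← List.reverse_reverse l, e]
        simp
      · intro h
        apply hl
        rw [← List.reverse_reverse l, e]
        simp [List.mem_reverse.1 h]
    · exact ⟨l ++ A, B, by simp, fun h => hm (by simp [h]), by simp [hl, hA]⟩

/-- The displayed `d` is the occurrence whose value contains the last `a`. -/
theorem exists_last_of_mem_flatMap {φ : ℕ → List ℕ} {a : ℕ} {p : List ℕ} (h : a ∈ p.flatMap φ) :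
    ∃ p₁ d p₂, p = p₁ ++ d :: p₂ ∧ a ∈ φ d ∧ a ∉ p₂.flatMap φ := by
  induction p with
  | nil => simp at h
  | cons c p ih =>
    by_cases hp : a ∈ p.flatMap φ
    · obtain ⟨p₁, d, p₂, rfl, h₁, h₂⟩ := ih hp
      exact ⟨c :: p₁, d, p₂, rfl, h₁, h₂⟩
    · rw [List.flatMap_cons, List.mem_append] at h
      exact ⟨[], c, p, rfl, h.resolve_right hp, hp⟩

theorem mem_flatMap_of_mem {φ : ℕ → List ℕ} {a d : ℕ} {p : List ℕ} (hd : d ∈ p) (ha : a ∈ φ d) :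
    a ∈ p.flatMap φ := List.mem_flatMap.2 ⟨d, hd, ha⟩

theorem prod_map_flatMap {M : Type u} [Monoid M] (φ : ℕ → List ℕ) (ψ : ℕ → M) (p : List ℕ) :
    ((p.flatMap φ).map ψ).prod = (p.map fun c => ((φ c).map ψ).prod).prod := by
  induction p with
  | nil => rfl
  | cons c p ih => simp [ih]

end Lists

namespace Satisfies

variable {M : Type u} [Monoid M] {p q : List ℕ}

theorem flatMap (h : Satisfies M p q) (φ : ℕ → List ℕ) :
    Satisfies M (p.flatMap φ) (q.flatMap φ) := fun ψ => by
  rw [prod_map_flatMap, prod_map_flatMap]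
  exact h _

theorem append_append (h : Satisfies M p q) (l m : List ℕ) :
    Satisfies M (l ++ p ++ m) (l ++ q ++ m) := fun ψ => by
  simp [h ψ]

end Satisfies

/-! ### What the test monoids detect -/

/-- Here `ab = 0`, while no product of `b`s followed by `a`s vanishes. -/
theorem A0Table.prod_eq_z_iff {x y : ℕ} (hxy : x ≠ y) (l : List ℕ) :
    (l.map fun c => if c = x then A0Table.a else if c = y then A0Table.b else 1).prod = A0Table.z ↔
      [x, y].Sublist l := by
  have key : ∀ k : A0Table, (A0Table.a * k = A0Table.z ↔ ¬ (k = 1 ∨ k = A0Table.a)) ∧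
      (A0Table.b * k = A0Table.z ↔ k = A0Table.z) ∧
      (A0Table.a * k = 1 ∨ A0Table.a * k = A0Table.a ↔ k = 1 ∨ k = A0Table.a) ∧
      ¬ (A0Table.b * k = 1 ∨ A0Table.b * k = A0Table.a) := by
    intro k
    change (A0Table.mul .a k = .z ↔ ¬ (k = .e ∨ k = .a)) ∧ (A0Table.mul .b k = .z ↔ k = .z) ∧
      (A0Table.mul .a k = .e ∨ A0Table.mul .a k = .a ↔ k = .e ∨ k = .a) ∧
      ¬ (A0Table.mul .b k = .e ∨ A0Table.mul .b k = .a)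
    cases k <;> simp [A0Table.mul]
  -- A left factor `a` gives zero unless the rest is `1` or `a`, so the induction also tracks when
  -- that happens.
  suffices H : ∀ l : List ℕ, ∀ P : A0Table,
      P = (l.map fun c => if c = x then A0Table.a else if c = y then A0Table.b else 1).prod →
      (P = A0Table.z ↔ [x, y].Sublist l) ∧ ((P = 1 ∨ P = A0Table.a) ↔ y ∉ l) from (H l _ rfl).1
  intro l
  induction l with
  | nil =>
    rintro P rfl
    refine ⟨?_, by simp⟩
    change (A0Table.e = A0Table.z ↔ _)
    simp
  | cons c l ih =>
    rintro P rfl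
    obtain ⟨h₁, h₂⟩ := ih _ rfl
    simp only [List.map_cons, List.prod_cons, List.cons_sublist_cons', List.singleton_sublist,
      List.mem_cons]
    by_cases hx : c = x
    · subst hx
      rw [if_pos rfl, (key _).1, (key _).2.2.1, h₂]
      refine ⟨⟨fun h => .inr ⟨rfl, not_not.1 h⟩, ?_⟩, by simp [hxy.symm]⟩
      rintro (h | ⟨-, h⟩)
      · exact not_not.2 (h.subset (by simp))
      · exact not_not.2 h
    · by_cases hy : c = y
      · subst hy
        rw [if_neg hx, if_pos rfl, (key _).2.1, h₁]
        exact ⟨by simp [hxy], by simp [(key _).2.2.2]⟩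
      · rw [if_neg hx, if_neg hy, one_mul, h₁, h₂]
        simp [Ne.symm hx, Ne.symm hy]

theorem Satisfies.pair_sublist_iff {p q : List ℕ} (h : Satisfies A0Table p q) {x y : ℕ}
    (hxy : x ≠ y) : [x, y].Sublist p ↔ [x, y].Sublist q := by
  rw [← A0Table.prod_eq_z_iff hxy, ← A0Table.prod_eq_z_iff hxy, h]

namespace FirstTable

/-- The substitution that marks the letters `x` and `y`. -/
def mark (x y c : ℕ) : FirstTable := if c = x then a else if c = y then b else 1

theorem mark_fst (x y : ℕ) : mark x y x = a := if_pos rfl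

theorem mark_snd {x y : ℕ} (h : x ≠ y) : mark x y y = b := by simp [mark, h.symm]

theorem mark_of_ne {x y c : ℕ} (hx : c ≠ x) (hy : c ≠ y) : mark x y c = 1 := by
  simp [mark, hx, hy]

theorem da_mul_mark (x y c : ℕ) : da * mark x y c = da := by
  unfold mark
  split_ifs <;> rfl

theorem db_mul_mark (x y c : ℕ) : db * mark x y c = db := by
  unfold mark
  split_ifs <;> rfl

theorem da_mul_prod (x y : ℕ) (l : List ℕ) : da * (l.map (mark x y)).prod = da := by
  induction l with
  | nil => rfl
  | cons c l ih => rw [List.map_cons, List.prod_cons, ← mul_assoc, da_mul_mark, ih]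

theorem db_mul_prod (x y : ℕ) (l : List ℕ) : db * (l.map (mark x y)).prod = db := by
  induction l with
  | nil => rfl
  | cons c l ih => rw [List.map_cons, List.prod_cons, ← mul_assoc, db_mul_mark, ih]

/-- The first marked letter after `d` decides, because `da` and `db` absorb all later marks. -/
theorem d_mul_prod_eq_db_iff {x y : ℕ} (h : x ≠ y) (l : List ℕ) :
    d * (l.map (mark x y)).prod = db ↔ FirstBefore y x l := by
  induction l with
  | nil => exact iff_of_false (fun h => FirstTable.noConfusion h) (not_firstBefore_nil y x)
  | cons c l ih =>
    rw [List.map_cons, List.prod_cons, ← mul_assoc]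
    by_cases hx : c = x
    · subst hx
      rw [mark_fst, show d * a = da from rfl, da_mul_prod]
      exact iff_of_false (fun h => FirstTable.noConfusion h) (not_firstBefore_cons h l)
    · by_cases hy : c = y
      · subst hy
        rw [mark_snd h, show d * b = db from rfl, db_mul_prod]
        exact iff_of_true rfl (firstBefore_cons_self c x l)
      · rw [mark_of_ne hx hy, mul_one, ih, firstBefore_cons_of_ne hx hy]

/-- Since `bd = d`, occurrences of `y` before the marker are harmless. -/
theorem prod_mul_d {x y : ℕ} {l : List ℕ} (hl : x ∉ l) : (l.map (mark x y)).prod * d = d := by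
  induction l with
  | nil => rfl
  | cons c l ih =>
    rw [List.map_cons, List.prod_cons, mul_assoc, ih fun h => hl (List.mem_cons_of_mem _ h), mark,
      if_neg fun h => hl (by simp [h])]
    split_ifs <;> rfl

end FirstTable

open FirstTable in
theorem Satisfies.mem_of_mem {p q : List ℕ} (h : Satisfies FirstTable p q) {c : ℕ} (hc : c ∈ p) :
    c ∈ q := by
  by_contra hq
  have key : ∀ l : List ℕ, (l.map fun k => if k = c then z else 1).prod = if c ∈ l then z else 1 := by
    intro l
    induction l with
    | nil => rfl
    | cons k l ih =>
      rw [List.map_cons, List.prod_cons, ih]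
      by_cases hk : k = c
      · simp only [hk, if_true, List.mem_cons_self]
        split_ifs <;> rfl
      · simp [hk, Ne.symm hk]
  have := h fun k => if k = c then z else 1
  rw [key, key, if_pos hc, if_neg hq] at this
  exact FirstTable.noConfusion this

open FirstTable in
/-- Inside the value of a letter `d` that occurs once, an identity of `FirstTable` preserves which
of `y` and `x` comes first to the right of a point before which there is no `x`. -/
theorem Satisfies.firstBefore_iff {p₁ p₂ q₁ q₂ : List ℕ} {c x y : ℕ} {φ : ℕ → List ℕ}
    (h : Satisfies FirstTable (p₁ ++ c :: p₂) (q₁ ++ c :: q₂)) (hxy : x ≠ y)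
    (hp₁ : c ∉ p₁) (hp₂ : c ∉ p₂) (hq₁ : c ∉ q₁) (hq₂ : c ∉ q₂)
    (hp : x ∉ p₁.flatMap φ) (hq : x ∉ q₁.flatMap φ) (δ : List ℕ) :
    FirstBefore y x (δ ++ p₂.flatMap φ) ↔ FirstBefore y x (δ ++ q₂.flatMap φ) := by
  have key : ∀ l : List ℕ, c ∉ l →
      (l.map fun k => if k = c then d * (δ.map (mark x y)).prod else
        ((φ k).map (mark x y)).prod).prod = ((l.flatMap φ).map (mark x y)).prod := by
    intro l hl
    rw [prod_map_flatMap]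
    refine congrArg List.prod (List.map_congr_left fun k hk => if_neg ?_)
    rintro rfl
    exact hl hk
  -- The marker `d` stands at the cut inside the value of `c`, and `δ` is the part of that value
  -- behind the cut.
  have := h fun k => if k = c then d * (δ.map (mark x y)).prod else ((φ k).map (mark x y)).prod
  simp only [List.map_append, List.map_cons, List.prod_append, List.prod_cons, if_true] at this
  rw [key _ hp₁, key _ hp₂, key _ hq₁, key _ hq₂, mul_assoc, ← mul_assoc _ d, prod_mul_d hp,
    mul_assoc, ← mul_assoc _ d, prod_mul_d hq, ← List.prod_append, ← List.prod_append,
    ← List.map_append, ← List.map_append] at this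
  rw [← d_mul_prod_eq_db_iff hxy, this, d_mul_prod_eq_db_iff hxy]

/-! ### Insertion of a letter -/

theorem satisfies_A0Table_insert {y : ℕ} {P Q : List ℕ} (hP : y ∈ P) (hQ : y ∈ Q) :
    Satisfies A0Table (P ++ Q) (P ++ y :: Q) := by
  obtain ⟨P₁, P₂, rfl⟩ := List.append_of_mem hP
  obtain ⟨Q₁, Q₂, rfl⟩ := List.append_of_mem hQ
  intro ψ
  simp only [List.map_append, List.map_cons, List.prod_append, List.prod_cons]
  have := A0Table.mul_mul_mul_self (ψ y) (P₂.map ψ).prod (Q₁.map ψ).prod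
  simpa only [mul_assoc] using
    congrArg (fun k => (P₁.map ψ).prod * k * (Q₂.map ψ).prod) this.symm

namespace ETable

/-- The ideal of the elements that involve `a`. -/
def Bad (k : ETable) : Prop := k = a ∨ k = ac ∨ k = z

theorem Bad.mul_left {k : ETable} (h : Bad k) (l : ETable) : Bad (l * k) := by
  rcases h with rfl | rfl | rfl <;> cases l <;>
    first | exact .inl rfl | exact .inr (.inl rfl) | exact .inr (.inr rfl)

theorem Bad.mul_right {k : ETable} (h : Bad k) (l : ETable) : Bad (k * l) := by
  rcases h with rfl | rfl | rfl <;> cases l <;>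
    first | exact .inl rfl | exact .inr (.inl rfl) | exact .inr (.inr rfl)

/-- The ideal has square zero, from `a² = 0` and `ca = a`. -/
theorem Bad.mul {k l : ETable} (hk : Bad k) (hl : Bad l) : k * l = z := by
  rcases hk with rfl | rfl | rfl <;> rcases hl with rfl | rfl | rfl <;> rfl

theorem Bad.prod {ψ : ℕ → ETable} {c : ℕ} (hc : Bad (ψ c)) {l : List ℕ} (hl : c ∈ l) :
    Bad (l.map ψ).prod := by
  induction l with
  | nil => simp at hl
  | cons k l ih =>
    rw [List.map_cons, List.prod_cons]
    rcases List.mem_cons.1 hl with rfl | hl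
    · exact hc.mul_right _
    · exact (ih hl).mul_left _

theorem Bad.prod_eq_z {ψ : ℕ → ETable} {c : ℕ} (hc : Bad (ψ c)) {l : List ℕ}
    (hl : [c, c].Sublist l) : (l.map ψ).prod = z := by
  induction l with
  | nil => simp at hl
  | cons k l ih =>
    rw [List.map_cons, List.prod_cons]
    rcases List.cons_sublist_cons'.1 hl with h | ⟨rfl, h⟩
    · rw [ih h, mul_z]
    · exact hc.mul (hc.prod (List.singleton_sublist.1 h))

/-- Outside the ideal remain `1, b, c`, a left zero band with an identity. -/
theorem mul_mul_self {k l : ETable} (hk : ¬ Bad k) (hl : ¬ Bad l) : k * l * k = k * l := by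
  cases k <;> cases l <;>
    first
      | rfl
      | exact absurd (.inl rfl) hk
      | exact absurd (.inr (.inl rfl)) hk
      | exact absurd (.inr (.inr rfl)) hk
      | exact absurd (.inl rfl) hl

theorem not_bad_mul {k l : ETable} (hk : ¬ Bad k) (hl : ¬ Bad l) : ¬ Bad (k * l) := by
  cases k <;> cases l <;>
    first
      | assumption
      | exact absurd (.inl rfl) hk
      | exact absurd (.inr (.inl rfl)) hk

theorem not_bad_prod {ψ : ℕ → ETable} {l : List ℕ} (h : ∀ c ∈ l, ¬ Bad (ψ c)) :
    ¬ Bad (l.map ψ).prod := by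
  induction l with
  | nil => rintro (h | h | h) <;> exact ETable.noConfusion h
  | cons k l ih =>
    rw [List.map_cons, List.prod_cons]
    exact not_bad_mul (h k (by simp)) (ih fun c hc => h c (List.mem_cons_of_mem _ hc))

theorem prod_mul_of_mem {ψ : ℕ → ETable} {l : List ℕ} (h : ∀ c ∈ l, ¬ Bad (ψ c)) {y : ℕ}
    (hy : y ∈ l) : (l.map ψ).prod * ψ y = (l.map ψ).prod := by
  induction l with
  | nil => simp at hy
  | cons k l ih =>
    have hl : ∀ c ∈ l, ¬ Bad (ψ c) := fun c hc => h c (List.mem_cons_of_mem _ hc)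
    rw [List.map_cons, List.prod_cons]
    rcases List.mem_cons.1 hy with rfl | hy
    · exact mul_mul_self (h y (by simp)) (not_bad_prod hl)
    · rw [mul_assoc, ih hl hy]

end ETable

/-- If some letter takes a value in the ideal, its two occurrences make both sides zero. Otherwise
all values lie in a left regular band, where a repeated `y` disappears. -/
theorem satisfies_ETable_insert {y : ℕ} {P Q : List ℕ} (hP : y ∈ P)
    (h : ∀ c ∈ P ++ Q, [c, c].Sublist (P ++ Q)) : Satisfies ETable (P ++ Q) (P ++ y :: Q) := by
  intro ψ
  by_cases hb : ∃ c ∈ P ++ Q, ETable.Bad (ψ c)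
  · obtain ⟨c, hc, hb⟩ := hb
    have hs : (P ++ Q).Sublist (P ++ y :: Q) := (List.sublist_cons_self y Q).append_left P
    rw [hb.prod_eq_z (h c hc), hb.prod_eq_z ((h c hc).trans hs)]
  · push Not at hb
    simp only [List.map_append, List.map_cons, List.prod_append, List.prod_cons]
    rw [← mul_assoc, ETable.prod_mul_of_mem (fun c hc => hb c (List.mem_append_left _ hc)) hP]

/-! ### The words that separate -/

/-- The letters `z₀, z₁, …`. -/
def zLetter (i : ℕ) : ℕ := 2 * i + 1

/-- The letters `w₀, w₁, …`. -/
def wLetter (i : ℕ) : ℕ := 2 * i + 2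

/-- The word `z₀w₀z₁w₁⋯zₙ₋₁wₙ₋₁`. -/
def zwWord (n : ℕ) : List ℕ := (List.range n).flatMap fun i => [zLetter i, wLetter i]

/-- The word `z₀z₁⋯zₙ₋₁ y z₀`, where `y` is the letter `0`. -/
def leftWord (n : ℕ) : List ℕ := (List.range n).map zLetter ++ [0, zLetter 0]

/-- The word `w₀z₁w₁⋯zₙ₋₁wₙ₋₁ y w₀w₁⋯wₙ₋₁`, where `y` is the letter `0`. -/
def rightWord (n : ℕ) : List ℕ := (zwWord n).tail ++ 0 :: (List.range n).map wLetter

theorem zwWord_eq {n : ℕ} (hn : 0 < n) : zwWord n = zLetter 0 :: (zwWord n).tail := by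
  obtain ⟨m, rfl⟩ := Nat.exists_eq_succ_of_ne_zero hn.ne'
  simp [zwWord, List.range_succ_eq_map]

/-- The `z₀` that ends `leftWord` is the head missing from `rightWord`; the insertion point lies
just behind it. -/
theorem leftWord_append_rightWord {n : ℕ} (hn : 0 < n) :
    leftWord n ++ rightWord n =
      (List.range n).map zLetter ++ 0 :: (zwWord n ++ 0 :: (List.range n).map wLetter) := by
  conv_rhs => rw [zwWord_eq hn]
  simp [leftWord, rightWord]

theorem mem_zwWord {n c : ℕ} :
    c ∈ zwWord n ↔ ∃ i < n, c = zLetter i ∨ c = wLetter i := by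
  simp [zwWord]

theorem zLetter_ne_wLetter (i j : ℕ) : zLetter i ≠ wLetter j := by
  unfold zLetter wLetter
  omega

theorem zLetter_inj {i j : ℕ} : zLetter i = zLetter j ↔ i = j := by
  unfold zLetter
  omega

theorem wLetter_inj {i j : ℕ} : wLetter i = wLetter j ↔ i = j := by
  unfold wLetter
  omega

theorem zero_notMem_zwWord (n : ℕ) : 0 ∉ zwWord n := by
  simp [mem_zwWord, zLetter, wLetter]

theorem wLetter_zLetter_sublist_zwWord {i j n : ℕ} :
    [wLetter i, zLetter j].Sublist (zwWord n) ↔ i < j ∧ j < n := by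
  induction n with
  | zero => simp [zwWord]
  | succ n ih =>
    rw [show zwWord (n + 1) = zwWord n ++ [zLetter n, wLetter n] by simp [zwWord, List.range_succ],
      pair_sublist_append, ih]
    simp only [mem_zwWord, List.mem_cons, List.cons_sublist_cons', List.singleton_sublist,
      zLetter_inj, wLetter_inj, zLetter_ne_wLetter, (zLetter_ne_wLetter _ _).symm]
    simp
    omega

/-- The outer blocks put `z`s in front and `w`s at the end, so only `zwWord` contributes. -/
theorem wLetter_zLetter_sublist {i j n : ℕ} (hj : j < n) :
    [wLetter i, zLetter j].Sublist (leftWord n ++ rightWord n) ↔ i < j := by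
  have hz : ∀ i, zLetter i ≠ 0 := fun i => Nat.succ_ne_zero _
  have hw : ∀ i, wLetter i ≠ 0 := fun i => Nat.succ_ne_zero _
  have h₁ : wLetter i ∉ (List.range n).map zLetter := by
    simp [zLetter_ne_wLetter]
  have h₂ : zLetter j ∉ (List.range n).map wLetter := by
    simp [(zLetter_ne_wLetter _ _).symm]
  rw [leftWord_append_rightWord (by omega), pair_sublist_append, List.cons_sublist_cons',
    pair_sublist_append, List.cons_sublist_cons', wLetter_zLetter_sublist_zwWord]
  have h₃ : ¬ [wLetter i, zLetter j].Sublist ((List.range n).map zLetter) :=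
    fun h => h₁ (h.subset (by simp))
  have h₄ : ¬ [wLetter i, zLetter j].Sublist ((List.range n).map wLetter) :=
    fun h => h₂ (h.subset (by simp))
  simp [h₁, h₂, h₃, h₄, hz, hw, hj, -List.mem_map]

theorem tail_zwWord (m : ℕ) : (zwWord (m + 1)).tail =
    wLetter 0 :: (List.range m).flatMap fun i => [zLetter (i + 1), wLetter (i + 1)] := by
  simp [zwWord, List.range_succ_eq_map (n := m), List.flatMap_map]

theorem wLetter_notMem_leftWord (i n : ℕ) : wLetter i ∉ leftWord n := by
  have hw : wLetter i ≠ 0 := Nat.succ_ne_zero _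
  simp [leftWord, zLetter_ne_wLetter, hw, (zLetter_ne_wLetter _ _).symm]

theorem zLetter_zero_notMem_rightWord {n : ℕ} (hn : 0 < n) : zLetter 0 ∉ rightWord n := by
  obtain ⟨m, rfl⟩ := Nat.exists_eq_succ_of_ne_zero hn.ne'
  have hz : zLetter 0 ≠ 0 := Nat.succ_ne_zero _
  simp [rightWord, tail_zwWord, zLetter_ne_wLetter, hz, (zLetter_ne_wLetter _ _).symm,
    zLetter_inj]

/-- The first `y` has a `z₀` behind it, and the second has `wₙ₋₁` in front of it. -/
theorem not_gap_leftWord_append_rightWord {n : ℕ} (hn : 2 ≤ n) :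
    ¬ Gap 0 (zLetter 0) (wLetter (n - 1)) (leftWord n ++ rightWord n) := by
  rw [gap_append_iff (wLetter_notMem_leftWord _ n) (zLetter_zero_notMem_rightWord (by omega)),
    not_or]
  obtain ⟨m, rfl⟩ : ∃ m, n = m + 2 := ⟨n - 2, by omega⟩
  constructor
  · rw [leftWord, List.reverse_append]
    exact not_firstBefore_cons (Nat.succ_ne_zero _) _
  · refine not_firstBefore_append ?_ ?_ _
    · exact fun h => zero_notMem_zwWord _ (List.mem_of_mem_tail h)
    · rw [tail_zwWord, List.mem_cons, List.mem_flatMap]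
      exact .inr ⟨m, by simp, by simp⟩

theorem pair_sublist_leftWord_append_rightWord {n c : ℕ} (hn : 0 < n)
    (hc : c ∈ leftWord n ++ rightWord n) : [c, c].Sublist (leftWord n ++ rightWord n) := by
  rw [leftWord_append_rightWord hn] at hc ⊢
  have h0 : [(0 : ℕ), 0].Sublist (0 :: (zwWord n ++ 0 :: (List.range n).map wLetter)) :=
    List.cons_sublist_cons.2 (List.singleton_sublist.2 (by simp))
  have hz : ∀ i < n, zLetter i ∈ zwWord n := fun i hi => mem_zwWord.2 ⟨i, hi, .inl rfl⟩
  have hw : ∀ i < n, wLetter i ∈ zwWord n := fun i hi => mem_zwWord.2 ⟨i, hi, .inr rfl⟩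
  have hz' : ∀ i < n, [zLetter i, zLetter i].Sublist ((List.range n).map zLetter ++
      0 :: (zwWord n ++ 0 :: (List.range n).map wLetter)) := fun i hi =>
    pair_sublist_append.2 (.inr (.inl ⟨List.mem_map.2 ⟨i, List.mem_range.2 hi, rfl⟩,
      List.mem_cons_of_mem _ (List.mem_append_left _ (hz i hi))⟩))
  have hw' : ∀ i < n, [wLetter i, wLetter i].Sublist ((List.range n).map zLetter ++
      0 :: (zwWord n ++ 0 :: (List.range n).map wLetter)) := fun i hi =>
    pair_sublist_append.2 (.inr (.inr (List.Sublist.cons _ (pair_sublist_append.2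
      (.inr (.inl ⟨hw i hi,
        List.mem_cons_of_mem _ (List.mem_map.2 ⟨i, List.mem_range.2 hi, rfl⟩)⟩))))))
  simp only [List.mem_append, List.mem_map, List.mem_range, List.mem_cons, mem_zwWord] at hc
  rcases hc with ⟨i, hi, rfl⟩ | rfl | ⟨i, hi, rfl | rfl⟩ | rfl | ⟨i, hi, rfl⟩
  · exact hz' i hi
  · exact pair_sublist_append.2 (.inr (.inr h0))
  · exact hz' i hi
  · exact hw' i hi
  · exact pair_sublist_append.2 (.inr (.inr h0))
  · exact hw' i hi

/-- The identity that holds in the upper bound of the theorem and needs many letters. -/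
def separatingIdentity (n : ℕ) : MonoidIdentity :=
  (FreeMonoid.ofList (leftWord n ++ rightWord n), FreeMonoid.ofList (leftWord n ++ 0 :: rightWord n))

theorem upper_le_ofIdentities_separatingIdentity {n : ℕ} (hn : 0 < n) :
    varietyA0.{u} ⊔ varietyE ⊔ varietyE.dual ≤
      MonoidVariety.ofIdentities {separatingIdentity n} := by
  have hl : 0 ∈ leftWord n := by simp [leftWord]
  have hr : 0 ∈ rightWord n := by simp [rightWord]
  have hd := fun c hc => pair_sublist_leftWord_append_rightWord (n := n) (c := c) hn hc
  apply upper_le_ofIdentities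
  · exact satisfies_A0Table_insert hl hr
  · exact satisfies_ETable_insert hl hd
  · have := satisfies_ETable_insert (P := (rightWord n).reverse) (Q := (leftWord n).reverse)
      (List.mem_reverse.2 hr) fun c hc => by
        rw [← List.reverse_append, List.mem_reverse] at hc
        rw [← List.reverse_append]
        simpa using (hd c hc).reverse
    simpa [separatingIdentity] using this

/-! ### Identities with few letters preserve the gap -/

section Invariance

variable {n : ℕ}

/-- The relative order of the letters `wᵢ` and `zⱼ` is as in the separating words. -/
def Ordered (n : ℕ) (U : List ℕ) : Prop :=
  ∀ i < n, ∀ j < n, [wLetter i, zLetter j].Sublist U ↔ i < j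

/-- Some `w₀` precedes a `zᵢ`, so it lies in `L`, and a `z₀` in `R` would follow it. Some `zⱼ`
follows a `wᵢ`, so it lies in `R`, and a `wₙ₋₁` in `L` would precede it. -/
theorem Ordered.split {L R : List ℕ} (h : Ordered n (L ++ R)) {i j : ℕ} (hi : 0 < i) (hij : i < j)
    (hj : j < n) (hw : wLetter i ∉ L) (hz : zLetter i ∉ R) :
    wLetter (n - 1) ∉ L ∧ zLetter 0 ∉ R := by
  have hp : ∀ a < n, ∀ b < n, ¬ a < b → ¬ (wLetter a ∈ L ∧ zLetter b ∈ R) := fun a ha b hb hab hm =>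
    hab ((h a ha b hb).1 (pair_sublist_append.2 (.inr (.inl hm))))
  have h₁ := pair_sublist_append.1 ((h i (by omega) j hj).2 hij)
  have h₂ := pair_sublist_append.1 ((h 0 (by omega) i (by omega)).2 hi)
  have hzR : zLetter j ∈ R := by
    rcases h₁ with h | h | h
    · exact absurd (h.subset (by simp)) hw
    · exact absurd h.1 hw
    · exact h.subset (by simp)
  have hwL : wLetter 0 ∈ L := by
    rcases h₂ with h | h | h
    · exact h.subset (by simp)
    · exact h.1
    · exact absurd (h.subset (by simp)) hz
  exact ⟨fun h => hp (n - 1) (by omega) j hj (by omega) ⟨h, hzR⟩,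
    fun h => hp 0 (by omega) 0 (by omega) (by omega) ⟨hwL, h⟩⟩

/-- With two occurrences of `d`, the `wᵢ` of the earlier would precede the `zᵢ` of the later. -/
theorem Ordered.notMem {p₁ p₂ : List ℕ} {d : ℕ} {φ : ℕ → List ℕ}
    (h : Ordered n ((p₁ ++ d :: p₂).flatMap φ)) {i : ℕ} (hi : i < n) (hz : zLetter i ∈ φ d)
    (hw : wLetter i ∈ φ d) : d ∉ p₁ ∧ d ∉ p₂ := by
  have key : ∀ l m : List ℕ, l ++ m = p₁ ++ d :: p₂ → d ∈ l → d ∉ m := fun l m e hl hm => by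
    rw [← e, List.flatMap_append] at h
    exact lt_irrefl i ((h i hi i hi).1 (pair_sublist_append.2
      (.inr (.inl ⟨mem_flatMap_of_mem hl hw, mem_flatMap_of_mem hm hz⟩))))
  exact ⟨fun hd => key p₁ (d :: p₂) rfl hd (by simp),
    fun hd => key (p₁ ++ [d]) p₂ (by simp) (by simp) hd⟩

/-- The two halves of the value of a word, cut inside a letter `d` that contains `zᵢ` and `wᵢ`. -/
theorem Ordered.halves {p₁ p₂ δ₁ δ₂ : List ℕ} {d : ℕ} {φ : ℕ → List ℕ}
    (h : Ordered n ((p₁ ++ d :: p₂).flatMap φ)) (hδ : φ d = δ₁ ++ δ₂) {i j : ℕ} (hi : 0 < i)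
    (hij : i < j) (hj : j < n) (hz₁ : zLetter i ∈ δ₁) (hz₂ : zLetter i ∉ δ₂)
    (hw₁ : wLetter i ∉ δ₁) (hw₂ : wLetter i ∈ δ₂) :
    wLetter (n - 1) ∉ p₁.flatMap φ ++ δ₁ ∧ zLetter 0 ∉ δ₂ ++ p₂.flatMap φ := by
  have e : (p₁ ++ d :: p₂).flatMap φ = (p₁.flatMap φ ++ δ₁) ++ (δ₂ ++ p₂.flatMap φ) := by
    simp [hδ]
  rw [e] at h
  have hp : ∀ l m : List ℕ, l ++ m = (p₁.flatMap φ ++ δ₁) ++ (δ₂ ++ p₂.flatMap φ) →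
      wLetter i ∈ l → zLetter i ∉ m := fun l m e hl hm => by
    rw [← e] at h
    exact lt_irrefl i ((h i (by omega) i (by omega)).1
      (pair_sublist_append.2 (.inr (.inl ⟨hl, hm⟩))))
  refine h.split hi hij hj ?_ ?_
  · intro hw
    rw [List.mem_append, or_iff_left hw₁] at hw
    exact hp (p₁.flatMap φ) (δ₁ ++ (δ₂ ++ p₂.flatMap φ)) (by simp) hw (by simp [hz₁])
  · intro hz
    rw [List.mem_append, or_iff_right hz₂] at hz
    exact hp (p₁.flatMap φ ++ δ₁ ++ δ₂) (p₂.flatMap φ) (by simp) (by simp [hw₂]) hz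

/-- A word with few letters whose value is ordered has a letter whose value contains the last `zᵢ`
and, to the right of it, the first `wᵢ`. -/
theorem Ordered.exists_letter {p : List ℕ} {φ : ℕ → List ℕ} (h : Ordered n (p.flatMap φ))
    (hp : p.toFinset.card + 1 < n) :
    ∃ i j d p₁ p₂ δ₁ δ₂, 0 < i ∧ i < j ∧ j < n ∧ p = p₁ ++ d :: p₂ ∧ φ d = δ₁ ++ δ₂ ∧
      zLetter i ∈ δ₁ ∧ zLetter i ∉ δ₂ ∧ wLetter i ∉ δ₁ ∧ wLetter i ∈ δ₂ := by
  -- The index `0` is left out because `Ordered.split` needs a `w₀` before the last `zᵢ`; the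
  -- pigeonhole then has `n - 1` indices.
  have hlast : ∀ i ∈ Finset.Ico 1 n, ∃ d, ∃ p₁ p₂, p = p₁ ++ d :: p₂ ∧ zLetter i ∈ φ d ∧
      zLetter i ∉ p₂.flatMap φ := by
    intro i hi
    rw [Finset.mem_Ico] at hi
    have : zLetter i ∈ p.flatMap φ :=
      ((h 0 (by omega) i hi.2).2 (by omega)).subset (by simp)
    obtain ⟨p₁, d, p₂, e⟩ := exists_last_of_mem_flatMap this
    exact ⟨d, p₁, p₂, e⟩
  choose! f hf using hlast
  obtain ⟨i, hi, j, hj, hne, hfij⟩ := Finset.exists_ne_map_eq_of_card_lt_of_maps_to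
    (s := Finset.Ico 1 n) (t := p.toFinset) (f := f) (by simp; omega) (by
      intro i hi
      obtain ⟨p₁, p₂, e, -⟩ := hf i hi
      simp [e])
  wlog hij : i < j generalizing i j
  · exact this j hj i hi hne.symm hfij.symm (by omega)
  obtain ⟨p₁, p₂, e, hzi, hzi'⟩ := hf i hi
  obtain ⟨p₁', p₂', e', hzj, hzj'⟩ := hf j hj
  rw [← hfij] at e' hzj
  rw [Finset.mem_Ico] at hi hj
  have hn : f i ∉ p₂ := fun hm => hzi' (mem_flatMap_of_mem hm hzi)
  have hn' : f i ∉ p₂' := fun hm => hzj' (mem_flatMap_of_mem hm hzj)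
  -- Both factorizations are at the last occurrence of the same letter.
  have hpp : p₂ = p₂' := by
    rcases List.append_eq_append_iff.1 (e.symm.trans e') with ⟨C, -, hC⟩ | ⟨C, -, hC⟩ <;>
      cases C <;> simp only [List.nil_append, List.cons_append, List.cons.injEq, true_and] at hC
    · exact hC
    · exact absurd (by simp [hC.2]) hn
    · exact hC.symm
    · exact absurd (by simp [hC.2]) hn'
  subst hpp
  -- With singleton values this locates the last `zᵢ` inside `φ d`; the cut is made just behind it.
  obtain ⟨δ₁, δ₂, hδ⟩ := exists_last_of_mem_flatMap (φ := fun c => [c])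
    (a := zLetter i) (p := φ (f i)) (by simpa using hzi)
  obtain ⟨γ, hδ, hγ, hz₂⟩ := hδ
  rw [List.mem_singleton] at hγ
  subst hγ
  rw [show (γ.flatMap fun c => [c]) = γ by simp] at hz₂
  have hw₁ : wLetter i ∉ p₁.flatMap φ ++ δ₁ := fun hw =>
    lt_irrefl i ((h i hi.2 i hi.2).1 (by
      rw [e, show (p₁ ++ f i :: p₂).flatMap φ =
        (p₁.flatMap φ ++ δ₁) ++ (zLetter i :: γ ++ p₂.flatMap φ) by simp [hδ]]
      exact pair_sublist_append.2 (.inr (.inl ⟨hw, by simp⟩))))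
  -- Otherwise every `wᵢ` would come after the value of `d`, where no `zⱼ` is left to follow it.
  have hw₂ : wLetter i ∈ γ := by
    by_contra hw
    have hl : wLetter i ∉ p₁.flatMap φ ++ δ₁ ++ zLetter i :: γ := by
      rw [List.mem_append, List.mem_cons]
      rintro (h | h | h)
      · exact hw₁ h
      · exact zLetter_ne_wLetter _ _ h.symm
      · exact hw h
    have := (h i hi.2 j hj.2).2 hij
    rw [e, show (p₁ ++ f i :: p₂).flatMap φ =
        (p₁.flatMap φ ++ δ₁ ++ zLetter i :: γ) ++ p₂.flatMap φ by simp [hδ],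
      pair_sublist_append] at this
    rcases this with h | h | h
    · exact hl (h.subset (by simp))
    · exact hl h.1
    · exact hzj' (h.subset (by simp))
  refine ⟨i, j, f i, p₁, p₂, δ₁ ++ [zLetter i], γ, by omega, hij, hj.2, e, by simp [hδ], by simp,
    hz₂, ?_, hw₂⟩
  intro hw
  rw [List.mem_append, List.mem_singleton, or_iff_left (zLetter_ne_wLetter _ _).symm] at hw
  exact hw₁ (List.mem_append_right _ hw)

/-- Both values are ordered, so the letter `d` found in `p` also occurs exactly once in `q`, and the
same cut of `φ d` splits both gaps. The right halves are compared by `FirstTable`, the left halves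
by the reversed identity. -/
theorem gap_iff_of_satisfies {p q : List ℕ} {φ : ℕ → List ℕ}
    (hp : Ordered n (p.flatMap φ)) (hq : Ordered n (q.flatMap φ)) (hcard : p.toFinset.card + 1 < n)
    (h : Satisfies FirstTable p q) (h' : Satisfies FirstTable p.reverse q.reverse) :
    Gap 0 (zLetter 0) (wLetter (n - 1)) (p.flatMap φ) ↔
      Gap 0 (zLetter 0) (wLetter (n - 1)) (q.flatMap φ) := by
  obtain ⟨i, j, d, p₁, p₂, δ₁, δ₂, hi, hij, hj, rfl, hδ, hz₁, hz₂, hw₁, hw₂⟩ :=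
    hp.exists_letter hcard
  obtain ⟨q₁, q₂, rfl⟩ := List.append_of_mem (h.mem_of_mem (c := d) (by simp))
  have hz : zLetter i ∈ φ d := by simp [hδ, hz₁]
  have hw : wLetter i ∈ φ d := by simp [hδ, hw₂]
  obtain ⟨hp₁, hp₂⟩ := hp.notMem (by omega) hz hw
  obtain ⟨hq₁, hq₂⟩ := hq.notMem (by omega) hz hw
  obtain ⟨hpl, hpr⟩ := hp.halves hδ hi hij hj hz₁ hz₂ hw₁ hw₂
  obtain ⟨hql, hqr⟩ := hq.halves hδ hi hij hj hz₁ hz₂ hw₁ hw₂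
  have e : ∀ l m : List ℕ, (l ++ d :: m).flatMap φ =
      (l.flatMap φ ++ δ₁) ++ (δ₂ ++ m.flatMap φ) := fun l m => by simp [hδ]
  have hrev : ∀ l : List ℕ, (l.flatMap φ).reverse = l.reverse.flatMap fun c => (φ c).reverse :=
    fun l => by rw [List.reverse_flatMap]; rfl
  rw [e, e, gap_append_iff hpl hpr, gap_append_iff hql hqr]
  simp only [List.mem_append, not_or] at hpl hpr hql hqr
  refine or_congr ?_ ?_
  · simp only [List.reverse_append, List.reverse_cons, List.append_assoc, List.singleton_append]
      at h'
    rw [List.reverse_append, List.reverse_append, hrev, hrev]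
    refine h'.firstBefore_iff (Nat.succ_ne_zero _) (by simpa) (by simpa) (by simpa) (by simpa) ?_ ?_ _
    · rw [← hrev, List.mem_reverse]
      exact hpr.2
    · rw [← hrev, List.mem_reverse]
      exact hqr.2
  · exact h.firstBefore_iff (Nat.succ_ne_zero _) hp₁ hp₂ hq₁ hq₂ hpl.1 hql.1 _

end Invariance

/-! ### The syntactic congruence -/

/-- The syntactic congruence of a set of words. -/
def syntacticCon (S : List ℕ → Prop) : Con (FreeMonoid ℕ) where
  r U W := ∀ l m : FreeMonoid ℕ, S (l * U * m).toList ↔ S (l * W * m).toList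
  iseqv := ⟨fun _ _ _ => Iff.rfl, fun h l m => (h l m).symm, fun h h' l m => (h l m).trans (h' l m)⟩
  mul' {U U' W W'} h h' l m := by
    have h₁ := h l (W * m)
    have h₂ := h' (l * U') m
    simp only [mul_assoc] at h₁ h₂ ⊢
    exact h₁.trans h₂

/-- The words that agree with the separating word in `A₀¹` and have no gap. -/
def Separated (n : ℕ) (U : List ℕ) : Prop :=
  Satisfies A0Table (leftWord n ++ rightWord n) U ∧ ¬ Gap 0 (zLetter 0) (wLetter (n - 1)) U

theorem Satisfies.ordered {n : ℕ} {U : List ℕ}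
    (h : Satisfies A0Table (leftWord n ++ rightWord n) U) : Ordered n U := fun i _ j hj => by
  rw [← h.pair_sublist_iff (zLetter_ne_wLetter j i).symm, wLetter_zLetter_sublist hj]

theorem separated_iff_of_satisfies {n : ℕ} {p q : List ℕ} (hcard : p.toFinset.card + 3 < n)
    (hA : Satisfies A0Table p q) (hE : Satisfies FirstTable p q)
    (hE' : Satisfies FirstTable p.reverse q.reverse) (φ : ℕ → List ℕ) (l m : List ℕ) :
    Separated n (l ++ p.flatMap φ ++ m) ↔ Separated n (l ++ q.flatMap φ ++ m) := by
  have hA' := (hA.flatMap φ).append_append l m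
  have hsat : Satisfies A0Table (leftWord n ++ rightWord n) (l ++ p.flatMap φ ++ m) ↔
      Satisfies A0Table (leftWord n ++ rightWord n) (l ++ q.flatMap φ ++ m) :=
    ⟨fun h ψ => (h ψ).trans (hA' ψ), fun h ψ => (h ψ).trans (hA' ψ).symm⟩
  -- The context `l`, `m` becomes the values of two new letters, which is why the bound on `p` is
  -- stricter by two.
  let φ' : ℕ → List ℕ
    | 0 => l
    | 1 => m
    | k + 2 => φ k
  have hφ : ∀ r : List ℕ, ([0] ++ r.map (· + 2) ++ [1]).flatMap φ' = l ++ r.flatMap φ ++ m :=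
    fun r => by simp [List.flatMap_map, φ']
  have hmap {M : Type} [Monoid M] {r s : List ℕ} (h : Satisfies M r s) :
      Satisfies M (r.map (· + 2)) (s.map (· + 2)) := fun ψ => by
    simpa only [List.map_map] using h (ψ ∘ (· + 2))
  have hc : ([0] ++ p.map (· + 2) ++ [1]).toFinset.card + 1 < n := by
    have h₁ : ([0] ++ p.map (· + 2) ++ [1]).toFinset = {0} ∪ p.toFinset.image (· + 2) ∪ {1} := by
      ext
      simp
    have h₂ := Finset.card_union_le ({0} ∪ p.toFinset.image (· + 2)) {1}
    have h₃ := Finset.card_union_le {0} (p.toFinset.image (· + 2))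
    have h₄ := Finset.card_image_le (s := p.toFinset) (f := (· + 2))
    rw [Finset.card_singleton] at h₂ h₃
    rw [h₁]
    omega
  have hgap (h : Satisfies A0Table (leftWord n ++ rightWord n) (l ++ p.flatMap φ ++ m)) :=
    gap_iff_of_satisfies (φ := φ') (by rw [hφ]; exact h.ordered)
      (by rw [hφ]; exact (hsat.1 h).ordered) hc ((hmap hE).append_append [0] [1])
      (by simpa using (hmap hE').append_append [1] [0])
  simp only [hφ] at hgap
  exact ⟨fun h => ⟨hsat.1 h.1, fun hg => h.2 ((hgap h.1).2 hg)⟩,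
    fun h => ⟨hsat.2 h.1, fun hg => h.2 ((hgap (hsat.2 h.1)).1 hg)⟩⟩

theorem mainTheorem6 (V : MonoidVariety.{u})
    (hlower : varietyA0 ⊔ varietyESigma2 ⊔ varietyESigma2.dual ≤ V)
    (hupper : V ≤ varietyA0 ⊔ varietyE ⊔ varietyE.dual) :
    ¬ V.IsFinitelyBased := by
  rintro ⟨Γ, hΓ, rfl⟩
  -- Left sides suffice: the pigeonhole is applied to them only.
  obtain ⟨N, hN⟩ : ∃ N, ∀ p ∈ Γ, p.1.toList.toFinset.card ≤ N := by
    obtain ⟨N, hN⟩ := (hΓ.image fun p : MonoidIdentity => p.1.toList.toFinset.card).bddAbove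
    exact ⟨N, fun p hp => hN ⟨p, hp, rfl⟩⟩
  obtain ⟨n, hn⟩ : ∃ n, n = N + 4 := ⟨_, rfl⟩
  let c := syntacticCon (Separated n)
  have hmem : (MonoidVariety.ofIdentities Γ).Mem (ULift.{u} c.Quotient) := by
    intro p hp
    obtain ⟨hA, hE, hE'⟩ := satisfies_tables_of_le hlower (p := p) fun M _ hM => hM p hp
    rw [MonoidIdentity.holdsIn_iff, satisfies_ulift_iff]
    intro ψ
    -- A substitution into the syntactic monoid is represented by a substitution `φ` of words.
    choose φ hφ using fun i => Con.mk'_surjective (c := c) (ψ i)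
    have key : ∀ r : List ℕ, (r.map ψ).prod = c.mk' (FreeMonoid.ofList (r.flatMap φ)) := by
      intro r
      induction r with
      | nil => rfl
      | cons i r ih =>
        rw [List.map_cons, List.prod_cons, ih, ← hφ, ← map_mul]
        rfl
    rw [key, key]
    refine (Con.eq c).2 fun l m => ?_
    exact separated_iff_of_satisfies (by have := hN p hp; omega) hA hE hE' φ l.toList m.toList
  have hsep : c (separatingIdentity n).1 (separatingIdentity n).2 := by
    have h := upper_le_ofIdentities_separatingIdentity (n := n) (by omega) _ (hupper _ hmem) _ rfl
    -- Each letter is sent to its own class, so the identity makes its two sides congruent.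
    have := h (MulEquiv.ulift.symm.toMonoidHom.comp c.mk')
    exact (Con.eq c).1 (congrArg ULift.down this)
  have h₁ : Separated n (leftWord n ++ rightWord n) :=
    ⟨fun _ => rfl, not_gap_leftWord_append_rightWord (by omega)⟩
  have h₂ : Separated n (leftWord n ++ 0 :: rightWord n) := by
    have := hsep 1 1
    rw [one_mul, one_mul, mul_one, mul_one] at this
    exact this.1 h₁
  exact h₂.2 ⟨leftWord n, rightWord n, rfl, zLetter_zero_notMem_rightWord (by omega),
    wLetter_notMem_leftWord _ n⟩
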